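/- All logarithms are base $2$. A state on a Hilbert space $\mathcal{H}$ is a positive semidefinite operator on $\mathcal{H}$ with trace $1$. For states $\rho,\sigma$ on $\mathcal{H}$ let $$F(\rho,\sigma)=\bigl\|\sqrt{\rho}\sqrt{\sigma}\bigr\|_1^2,\qquad P(\rho,\sigma)=\sqrt{1-F(\rho,\sigma)}$$ be the fidelity and the sine distance. For a state $\rho$ and a positive semidefinite operator $\sigma$ on $\mathcal{H}$ and $\varepsilon\in[0,1]$ let $$D_{\max}(\rho\Vert\sigma)=\inf\{\lambda\in\mathbb{R}:\rho\le 2^{\lambda}\sigma\},$$ $$D_{\max}^{\varepsilon}(\rho\Vert\sigma)=\inf\{\lambda\in\mathbb{R}:\widetilde\rho\le 2^{\lambda}\sigma\ \text{for some state}\ \widetilde\rho\ \text{on}\ \mathcal{H}\ \text{with}\ P(\widetilde\rho,\rho)\le\varepsilon\},$$ where $\inf\emptyset=+\infty$. For a state $\rho_{AE}$ on $\mathcal{H}_A\otimes\mathcal{H}_E$ with marginals $\rho_A=\operatorname{Tr}_E[\rho_{AE}]$ and $\rho_E=\operatorname{Tr}_A[\rho_{AE}]$, the alternate smooth max-mutual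 information is $$\widetilde I_{\max}^{\varepsilon}(E;A)_\rho=\inf\bigl\{D_{\max}(\widetilde\rho_{AE}\Vert\rho_A\otimes\widetilde\rho_E):\widetilde\rho_{AE}\ \text{a state on}\ \mathcal{H}_A\otimes\mathcal{H}_E\ \text{with}\ P(\widetilde\rho_{AE},\rho_{AE})\le\varepsilon\bigr\},\qquad \widetilde\rho_E=\operatorname{Tr}_A[\widetilde\rho_{AE}].$$ Lemma. Let $\mathcal{H}_A$ and $\mathcal{H}_E$ be separable complex Hilbert spaces, let $\rho_{AE}$ be a state on $\mathcal{H}_A\otimes\mathcal{H}_E$, and let $\varepsilon,\delta>0$ satisfy $\varepsilon+\delta<1$. Then $$\widetilde I_{\max}^{\varepsilon+\delta}(E;A)_\rho\le D_{\max}^{\varepsilon}(\rho_{AE}\Vert\rho_A\otimes\rho_E)+\log_2\!\left(\frac{8}{\delta^2}\right).$$ -/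

import Mathlib

open scoped ENNReal InnerProductSpace TensorProduct

noncomputable section

namespace QInfo

section Trace

variable {H : Type*} [NormedAddCommGroup H] [InnerProductSpace ℂ H] [CompleteSpace H]

variable (H) in
/-- Index set of a fixed orthonormal (Hilbert) basis of `H`. -/
def stdIndex : Set H := (exists_hilbertBasis ℂ H).choose

variable (H) in
/-- A fixed orthonormal (Hilbert) basis of `H`. -/
def stdBasis : HilbertBasis (stdIndex H) ℂ H := (exists_hilbertBasis ℂ H).choose_spec.choose

/-- The trace `Tr[T] = ∑ᵢ ⟨eᵢ, T eᵢ⟩ ∈ [0, ∞]` of a positive semidefinite bounded operator `T`.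
For `T ≥ 0` it does not depend on the orthonormal basis, see `posTrace_eq_tsum`. -/
def posTrace (T : H →L[ℂ] H) : ℝ≥0∞ :=
  ∑' i, ENNReal.ofReal (⟪stdBasis H i, T (stdBasis H i)⟫_ℂ).re

/-- Parseval's identity in `[0, ∞]`. -/
theorem tsum_ofReal_norm_inner_sq {ι : Type*} (b : HilbertBasis ι ℂ H) (x : H) :
    ∑' i, ENNReal.ofReal (‖⟪b i, x⟫_ℂ‖ ^ 2) = ENNReal.ofReal (‖x‖ ^ 2) := by
  have h := b.hasSum_inner_mul_inner x x
  have h2 : HasSum (fun i => ‖⟪b i, x⟫_ℂ‖ ^ 2) (‖x‖ ^ 2) := by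
    have := Complex.hasSum_re h
    convert this using 1
    · funext i
      have := inner_mul_symm_re_eq_norm (𝕜 := ℂ) x (b i)
      rw [norm_mul, norm_inner_symm x, ← sq] at this
      exact this.symm
    · exact norm_sq_eq_re_inner (𝕜 := ℂ) x
  rw [← ENNReal.ofReal_tsum_of_nonneg (fun _ => by positivity) h2.summable, h2.tsum_eq]

theorem adjoint_sqrt (T : H →L[ℂ] H) :
    ContinuousLinearMap.adjoint (CFC.sqrt T) = CFC.sqrt T :=
  (IsSelfAdjoint.of_nonneg (CFC.sqrt_nonneg T)).star_eq

theorem re_inner_eq_norm_sqrt_sq {T : H →L[ℂ] H} (hT : 0 ≤ T) (x : H) :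
    (⟪x, T x⟫_ℂ).re = ‖CFC.sqrt T x‖ ^ 2 := by
  have hx : T x = CFC.sqrt T (CFC.sqrt T x) := by
    conv_lhs => rw [← CFC.sqrt_mul_sqrt_self T hT]
    rfl
  rw [hx, ← ContinuousLinearMap.adjoint_inner_left, adjoint_sqrt]
  exact (norm_sq_eq_re_inner (𝕜 := ℂ) _).symm

theorem norm_inner_sqrt_comm (T : H →L[ℂ] H) (x y : H) :
    ‖⟪x, CFC.sqrt T y⟫_ℂ‖ = ‖⟪y, CFC.sqrt T x⟫_ℂ‖ := by
  rw [← ContinuousLinearMap.adjoint_inner_left, adjoint_sqrt, norm_inner_symm]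

/-- The trace of a positive semidefinite operator may be computed in any orthonormal basis. -/
theorem posTrace_eq_tsum {ι : Type*} (b : HilbertBasis ι ℂ H) {T : H →L[ℂ] H} (hT : 0 ≤ T) :
    posTrace T = ∑' i, ENNReal.ofReal (⟪b i, T (b i)⟫_ℂ).re := by
  simp only [posTrace, re_inner_eq_norm_sqrt_sq hT]
  simp_rw [fun i => (tsum_ofReal_norm_inner_sq b (CFC.sqrt T (stdBasis H i))).symm]
  rw [ENNReal.tsum_comm]
  congr 1
  funext j
  rw [← tsum_ofReal_norm_inner_sq (stdBasis H) (CFC.sqrt T (b j))]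
  congr 1
  funext i
  rw [norm_inner_sqrt_comm]

theorem tsum_orthonormal_le_posTrace {ι : Type*} {v : ι → H} (hv : Orthonormal ℂ v)
    {T : H →L[ℂ] H} (hT : 0 ≤ T) :
    ∑' i, ENNReal.ofReal (⟪v i, T (v i)⟫_ℂ).re ≤ posTrace T := by
  simp only [posTrace, re_inner_eq_norm_sqrt_sq hT]
  simp_rw [fun i => (tsum_ofReal_norm_inner_sq (stdBasis H) (CFC.sqrt T (v i))).symm]
  rw [ENNReal.tsum_comm]
  refine ENNReal.tsum_le_tsum fun k => ?_
  simp_rw [norm_inner_sqrt_comm T (stdBasis H k)]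
  rw [← ENNReal.ofReal_tsum_of_nonneg (fun _ => by positivity) (hv.inner_products_summable _)]
  exact ENNReal.ofReal_le_ofReal (hv.tsum_inner_products_le _)

/-- For `T ≥ 0` of finite trace and bounded `V j` sending an orthonormal basis `b` to vectors that
are jointly orthonormal in `(j, i)`, the series `∑ⱼ V j† T V j` converges absolutely. -/
theorem summable_compression {K : Type*} [NormedAddCommGroup K] [InnerProductSpace ℂ K]
    [CompleteSpace K] {ι κ : Type*} (b : HilbertBasis ι ℂ K) (V : κ → K →L[ℂ] H)
    (hV : Orthonormal ℂ fun p : κ × ι => V p.1 (b p.2)) {T : H →L[ℂ] H} (hT : 0 ≤ T)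
    (hfin : posTrace T ≠ ∞) :
    Summable fun j => ContinuousLinearMap.adjoint (V j) ∘L T ∘L V j := by
  have hle : ∀ j, ENNReal.ofReal ‖ContinuousLinearMap.adjoint (V j) ∘L T ∘L V j‖ ≤
      ∑' i, ENNReal.ofReal (⟪V j (b i), T (V j (b i))⟫_ℂ).re := by
    intro j
    set W := CFC.sqrt T ∘L V j with hW
    have hWW : ContinuousLinearMap.adjoint (V j) ∘L T ∘L V j =
        ContinuousLinearMap.adjoint W ∘L W := by
      have hTT : T = CFC.sqrt T ∘L CFC.sqrt T := (CFC.sqrt_mul_sqrt_self T hT).symm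
      rw [hW, ContinuousLinearMap.adjoint_comp, adjoint_sqrt]
      conv_lhs => rw [hTT]
      rfl
    simp only [re_inner_eq_norm_sqrt_sq hT]
    change _ ≤ ∑' i, ENNReal.ofReal (‖W (b i)‖ ^ 2)
    rw [hWW, ContinuousLinearMap.norm_adjoint_comp_self, ← LinearIsometryEquiv.norm_map
      ContinuousLinearMap.adjoint W]
    set S := ∑' i, ENNReal.ofReal (‖W (b i)‖ ^ 2) with hS
    by_cases hStop : S = ∞
    · rw [hStop]; exact le_top
    have hbound : ∀ y, ‖ContinuousLinearMap.adjoint W y‖ ^ 2 ≤ S.toReal * ‖y‖ ^ 2 := by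
      intro y
      rw [← ENNReal.ofReal_le_ofReal_iff (by positivity), ENNReal.ofReal_mul (by positivity),
        ENNReal.ofReal_toReal hStop, ← tsum_ofReal_norm_inner_sq b, hS, ← ENNReal.tsum_mul_right]
      refine ENNReal.tsum_le_tsum fun i => ?_
      rw [← ENNReal.ofReal_mul (by positivity), ContinuousLinearMap.adjoint_inner_right,
        ← mul_pow]
      exact ENNReal.ofReal_le_ofReal (pow_le_pow_left₀ (norm_nonneg _) (norm_inner_le_norm _ _) 2)
    have hn : ‖ContinuousLinearMap.adjoint W‖ ≤ √S.toReal := by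
      refine ContinuousLinearMap.opNorm_le_bound _ (by positivity) fun y => ?_
      refine (sq_le_sq₀ (norm_nonneg _) (by positivity)).1 ?_
      rw [mul_pow, Real.sq_sqrt ENNReal.toReal_nonneg]
      exact hbound y
    refine ENNReal.ofReal_le_of_le_toReal ?_
    calc _ ≤ √S.toReal * √S.toReal := by gcongr
      _ = _ := Real.mul_self_sqrt ENNReal.toReal_nonneg
  refine Summable.of_norm ?_
  have h1 : ∑' j, ENNReal.ofReal ‖ContinuousLinearMap.adjoint (V j) ∘L T ∘L V j‖ ≠ ∞ := by
    refine ne_top_of_le_ne_top hfin ((ENNReal.tsum_le_tsum hle).trans ?_)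
    rw [← ENNReal.tsum_prod (f := fun j i => ENNReal.ofReal (⟪V j (b i), T (V j (b i))⟫_ℂ).re)]
    exact tsum_orthonormal_le_posTrace hV hT
  have h2 := ENNReal.summable_toReal h1
  simpa only [ENNReal.toReal_ofReal (norm_nonneg _)] using h2

/-- The trace norm `‖T‖₁ = Tr[|T|]`, with `|T| = √(T† T)`. -/
def traceNorm (T : H →L[ℂ] H) : ℝ≥0∞ := posTrace (CFC.abs T)

variable (H) in
/-- Quantum states (density operators) on `H`: positive semidefinite operators of trace one. -/
structure State where
  op : H →L[ℂ] H
  nonneg : 0 ≤ op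
  trace_eq_one : posTrace op = 1

/-- Fidelity `F(ρ, σ) = ‖√ρ √σ‖₁²`. -/
def fidelity (ρ σ : State H) : ℝ :=
  (traceNorm (CFC.sqrt ρ.op * CFC.sqrt σ.op)).toReal ^ 2

/-- Sine distance `P(ρ, σ) = √(1 - F(ρ, σ))`. -/
def sineDistance (ρ σ : State H) : ℝ := √(1 - fidelity ρ σ)

/-- Max-relative entropy `D_max(ρ‖σ) = inf {l ∈ ℝ : ρ ≤ 2^l σ}`, which is `+∞` if there is no
such `l`; `≤` is the Loewner order. -/
def maxRelEntropy (ρ : State H) (σ : H →L[ℂ] H) : EReal :=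
  ⨅ (l : ℝ) (_ : ρ.op ≤ (((2 : ℝ) ^ l : ℝ) : ℂ) • σ), (l : EReal)

/-- Smooth max-relative entropy `D_max^ε(ρ‖σ)`: the infimum of all real `l` such that
`τ ≤ 2^l σ` for some state `τ` with `P(τ, ρ) ≤ ε`. -/
def smoothMaxRelEntropy (ε : ℝ) (ρ : State H) (σ : H →L[ℂ] H) : EReal :=
  ⨅ (l : ℝ) (_ : ∃ τ : State H,
    τ.op ≤ (((2 : ℝ) ^ l : ℝ) : ℂ) • σ ∧ sineDistance τ ρ ≤ ε), (l : EReal)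

end Trace

section Bipartite

variable (HA HE : Type*) [NormedAddCommGroup HA] [InnerProductSpace ℂ HA]
  [NormedAddCommGroup HE] [InnerProductSpace ℂ HE]

/-- Hilbert space tensor product: the completion of the algebraic tensor product for the inner
product with `⟨x ⊗ y, x' ⊗ y'⟩ = ⟨x, x'⟩⟨y, y'⟩`. -/
abbrev HTensor : Type _ := UniformSpace.Completion (HA ⊗[ℂ] HE)

variable {HA HE}

/-- The tensor product `S ⊗ T` of bounded operators. -/
def opTensor (S : HA →L[ℂ] HA) (T : HE →L[ℂ] HE) : HTensor HA HE →L[ℂ] HTensor HA HE :=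
  (TensorProduct.mapL S T).completion

theorem opTensor_tmul (S : HA →L[ℂ] HA) (T : HE →L[ℂ] HE) (x : HA) (y : HE) :
    opTensor S T ((x ⊗ₜ[ℂ] y : HA ⊗[ℂ] HE) : HTensor HA HE) =
      ((S x ⊗ₜ[ℂ] T y : HA ⊗[ℂ] HE) : HTensor HA HE) :=
  UniformSpace.Completion.map_coe (TensorProduct.mapL S T).uniformContinuous _

/-- The bounded operator `x ↦ x ⊗ y`. -/
def tensorRight (y : HE) : HA →L[ℂ] HTensor HA HE :=
  UniformSpace.Completion.toComplL ∘L (TensorProduct.mkL ℂ HA HE).flip y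

/-- The bounded operator `y ↦ x ⊗ y`. -/
def tensorLeft (x : HA) : HE →L[ℂ] HTensor HA HE :=
  UniformSpace.Completion.toComplL ∘L TensorProduct.mkL ℂ HA HE x

theorem tensorRight_apply (x : HA) (y : HE) :
    tensorRight y x = ((x ⊗ₜ[ℂ] y : HA ⊗[ℂ] HE) : HTensor HA HE) := rfl

theorem tensorLeft_apply (x : HA) (y : HE) :
    tensorLeft x y = ((x ⊗ₜ[ℂ] y : HA ⊗[ℂ] HE) : HTensor HA HE) := rfl

variable [CompleteSpace HA] [CompleteSpace HE]

/-- Partial trace over `E`: `T_A = ∑ⱼ (1 ⊗ ⟨fⱼ|) T (1 ⊗ |fⱼ⟩)` for an orthonormal basis `f` of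
`HE`. For states the series converges in operator norm, see
`summable_marginalA`. -/
def marginalA (T : HTensor HA HE →L[ℂ] HTensor HA HE) : HA →L[ℂ] HA :=
  ∑' j, ContinuousLinearMap.adjoint (tensorRight (stdBasis HE j)) ∘L T ∘L
    tensorRight (stdBasis HE j)

/-- Partial trace over `A`: `T_E = ∑ᵢ (⟨eᵢ| ⊗ 1) T (|eᵢ⟩ ⊗ 1)` for an orthonormal basis `e` of
`HA`. For states the series converges in operator norm, see
`summable_marginalE`. -/
def marginalE (T : HTensor HA HE →L[ℂ] HTensor HA HE) : HE →L[ℂ] HE :=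
  ∑' i, ContinuousLinearMap.adjoint (tensorLeft (stdBasis HA i)) ∘L T ∘L
    tensorLeft (stdBasis HA i)

theorem summable_marginalA (ρ : State (HTensor HA HE)) :
    Summable fun j => ContinuousLinearMap.adjoint (tensorRight (HA := HA) (stdBasis HE j)) ∘L
      ρ.op ∘L tensorRight (stdBasis HE j) := by
  refine summable_compression (stdBasis HA) _ ?_ ρ.nonneg (by simp [ρ.trace_eq_one])
  have h := (stdBasis HA).orthonormal.tmul (stdBasis HE).orthonormal
  have h' := h.comp_linearIsometry (UniformSpace.Completion.toComplₗᵢ (𝕜 := ℂ))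
  exact h'.comp Prod.swap Prod.swap_injective

theorem summable_marginalE (ρ : State (HTensor HA HE)) :
    Summable fun i => ContinuousLinearMap.adjoint (tensorLeft (HE := HE) (stdBasis HA i)) ∘L
      ρ.op ∘L tensorLeft (stdBasis HA i) := by
  refine summable_compression (stdBasis HE) _ ?_ ρ.nonneg (by simp [ρ.trace_eq_one])
  have h := (stdBasis HA).orthonormal.tmul (stdBasis HE).orthonormal
  exact h.comp_linearIsometry (UniformSpace.Completion.toComplₗᵢ (𝕜 := ℂ))

/-- The mutual-information-like quantity `D_max^ε(ρ_AE ‖ ρ_A ⊗ ρ_E)`. -/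
def smoothMaxInfo (ε : ℝ) (ρ : State (HTensor HA HE)) : EReal :=
  smoothMaxRelEntropy ε ρ (opTensor (marginalA ρ.op) (marginalE ρ.op))

/-- Alternate smooth max-mutual information
`Ĩ_max^ε(E;A)_ρ = inf {D_max(τ_AE ‖ ρ_A ⊗ τ_E) : τ_AE a state with P(τ_AE, ρ_AE) ≤ ε}`. -/
def altSmoothMaxInfo (ε : ℝ) (ρ : State (HTensor HA HE)) : EReal :=
  ⨅ (τ : State (HTensor HA HE)) (_ : sineDistance τ ρ ≤ ε),
    maxRelEntropy τ (opTensor (marginalA ρ.op) (marginalE τ.op))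

end Bipartite

end QInfo

end

open scoped ENNReal InnerProductSpace TensorProduct

noncomputable section

namespace QInfo

/-! ### Quadratic forms and the trace. -/

section Trace

variable {H : Type*} [NormedAddCommGroup H] [InnerProductSpace ℂ H] [CompleteSpace H]

/-! Take τ with τ ≤ 2^l ρ_A ⊗ ρ_E and P(τ, ρ) ≤ ε, and mix in a little of the product: ω = (1 - η) τ
+ η ρ_A ⊗ ρ_E with η = δ²/8. Its marginal satisfies ω_E ≥ η ρ_E, so ρ_A ⊗ ω_E ≥ η ρ_A ⊗ ρ_E
(`smul_prodMarginals_le`). Comparing traces gives 2^l ≥ 1, so ω ≤ 2^l ρ_A ⊗ ρ_E as well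
(`mix_op_le`). Hence ω ≤ (2^l / η) ρ_A ⊗ ω_E, and the price is log(1/η) = log(8/δ²).

Smoothing costs little: ω ≥ (1 - η) τ and operator monotonicity of the square root give F(ω, ρ) ≥ (1
- η) F(τ, ρ) (`mul_fidelity_le`). Together with F ≤ 1 this yields P(ω, ρ)² ≤ ε² + η ≤ (ε + δ)²
(`sineDistance_mix_le`).

In infinite dimension the remaining work is to show F ≤ 1, that marginals of states have trace one,
and that ρ_A ⊗ ρ_E is a state with E-marginal ρ_E. -/

theorem inner_eq_norm_sqrt_sq {T : H →L[ℂ] H} (hT : 0 ≤ T) (x : H) :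
    ⟪x, T x⟫_ℂ = ((‖CFC.sqrt T x‖ ^ 2 : ℝ) : ℂ) := by
  have hx : T x = CFC.sqrt T (CFC.sqrt T x) := by
    conv_lhs => rw [← CFC.sqrt_mul_sqrt_self T hT]
    rfl
  rw [hx, ← ContinuousLinearMap.adjoint_inner_left, adjoint_sqrt, inner_self_eq_norm_sq_to_K]
  norm_cast

theorem re_inner_nonneg {T : H →L[ℂ] H} (hT : 0 ≤ T) (x : H) : 0 ≤ (⟪x, T x⟫_ℂ).re := by
  rw [re_inner_eq_norm_sqrt_sq hT]
  positivity

theorem re_inner_mono {S T : H →L[ℂ] H} (h : S ≤ T) (x : H) :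
    (⟪x, S x⟫_ℂ).re ≤ (⟪x, T x⟫_ℂ).re := by
  have := re_inner_nonneg (sub_nonneg.2 h) x
  rw [sub_apply, inner_sub_right, Complex.sub_re] at this
  linarith

theorem posTrace_mono {S T : H →L[ℂ] H} (h : S ≤ T) : posTrace S ≤ posTrace T :=
  ENNReal.tsum_le_tsum fun _ => ENNReal.ofReal_le_ofReal (re_inner_mono h _)

theorem posTrace_add {S T : H →L[ℂ] H} (hS : 0 ≤ S) (hT : 0 ≤ T) :
    posTrace (S + T) = posTrace S + posTrace T := by
  rw [posTrace, posTrace, posTrace, ← ENNReal.tsum_add]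
  refine tsum_congr fun i => ?_
  rw [add_apply, inner_add_right, Complex.add_re,
    ENNReal.ofReal_add (re_inner_nonneg hS _) (re_inner_nonneg hT _)]

theorem posTrace_smul {r : ℝ} (hr : 0 ≤ r) (T : H →L[ℂ] H) :
    posTrace ((r : ℂ) • T) = ENNReal.ofReal r * posTrace T := by
  rw [posTrace, posTrace, ← ENNReal.tsum_mul_left]
  refine tsum_congr fun i => ?_
  rw [smul_apply, inner_smul_right, Complex.re_ofReal_mul,
    ENNReal.ofReal_mul hr]

open scoped ComplexOrder in
theorem coe_smul_nonneg {r : ℝ} (hr : 0 ≤ r) {T : H →L[ℂ] H} (hT : 0 ≤ T) :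
    0 ≤ (r : ℂ) • T :=
  smul_nonneg (Complex.zero_le_real.2 hr) hT

open scoped ComplexOrder in
theorem coe_smul_mono {r : ℝ} (hr : 0 ≤ r) {S T : H →L[ℂ] H} (h : S ≤ T) :
    (r : ℂ) • S ≤ (r : ℂ) • T :=
  smul_le_smul_of_nonneg_left h (Complex.zero_le_real.2 hr)

/-- Complex-valued form of the trace, needed where the diagonal entries act as scalars on operators.
-/
theorem hasSum_inner_of_posTrace_eq_one {T : H →L[ℂ] H} (hT : 0 ≤ T) (h : posTrace T = 1) :
    HasSum (fun i => ⟪stdBasis H i, T (stdBasis H i)⟫_ℂ) 1 := by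
  have h1 : HasSum (fun i => ‖CFC.sqrt T (stdBasis H i)‖ ^ 2) 1 := by
    simp only [posTrace, re_inner_eq_norm_sqrt_sq hT] at h
    have hs := ENNReal.summable_toReal (by rw [h]; exact ENNReal.one_ne_top)
    have := hs.hasSum
    rw [← ENNReal.tsum_toReal_eq (fun _ => ENNReal.ofReal_ne_top), h] at this
    simpa [ENNReal.toReal_ofReal] using this
  simp only [inner_eq_norm_sqrt_sq hT]
  rw [← Complex.ofReal_one]
  exact Complex.hasSum_ofReal.2 h1

/-! ### Fidelity is at most one. -/

/-- The squared Hilbert–Schmidt norm is invariant under taking adjoints. -/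
theorem tsum_norm_sq_adjoint {ι : Type*} (b : HilbertBasis ι ℂ H) (T : H →L[ℂ] H) :
    ∑' i, ENNReal.ofReal (‖ContinuousLinearMap.adjoint T (b i)‖ ^ 2) =
      ∑' i, ENNReal.ofReal (‖T (b i)‖ ^ 2) := by
  simp_rw [← tsum_ofReal_norm_inner_sq b]
  rw [ENNReal.tsum_comm]
  refine tsum_congr fun i => tsum_congr fun j => ?_
  rw [ContinuousLinearMap.adjoint_inner_right, norm_inner_symm]

theorem tsum_norm_sqrt_sq (ρ : State H) :
    ∑' i, ENNReal.ofReal (‖CFC.sqrt ρ.op (stdBasis H i)‖ ^ 2) = 1 := by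
  rw [← ρ.trace_eq_one, posTrace]
  simp only [re_inner_eq_norm_sqrt_sq ρ.nonneg]

/-- An approximate polar decomposition. -/
theorem exists_contraction_abs_le {𝒜 : Type*} [CStarAlgebra 𝒜] [PartialOrder 𝒜]
    [StarOrderedRing 𝒜] (x : 𝒜) {t : ℝ} (ht : 0 < t) :
    ∃ v : 𝒜, ‖v‖ ≤ 1 ∧ CFC.abs x ≤ star v * x + algebraMap ℝ 𝒜 t := by
  obtain ⟨a, ha⟩ : ∃ a, a = CFC.abs x := ⟨_, rfl⟩
  rw [← ha]
  have ha0 : 0 ≤ a := ha ▸ CFC.abs_nonneg x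
  have hxa : star x * x = a * a := by rw [ha, CFC.abs_mul_abs]
  have hsa : IsSelfAdjoint a := .of_nonneg ha0
  have hspec : ∀ s ∈ spectrum ℝ a, 0 ≤ s := fun s hs => spectrum_nonneg_of_nonneg ha0 hs
  have hcont : ContinuousOn (fun s : ℝ => (s + t)⁻¹) (spectrum ℝ a) :=
    ContinuousOn.inv₀ (by fun_prop) fun s hs => by have := hspec s hs; positivity
  have hsq : ContinuousOn (fun s : ℝ => s * s) (spectrum ℝ a) := by fun_prop
  have hid : ContinuousOn (fun s : ℝ => s) (spectrum ℝ a) := continuousOn_id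
  have hmul : ContinuousOn (fun s : ℝ => (s + t)⁻¹ * (s * s)) (spectrum ℝ a) := hcont.mul hsq
  obtain ⟨r, hr⟩ : ∃ r, r = cfc (fun s : ℝ => (s + t)⁻¹) a := ⟨_, rfl⟩
  have hrsa : star r = r := by
    rw [hr]
    exact (cfc_predicate (p := IsSelfAdjoint) (fun s : ℝ => (s + t)⁻¹) a).star_eq
  have hraa : r * (a * a) = cfc (fun s : ℝ => (s + t)⁻¹ * (s * s)) a := by
    rw [cfc_mul _ _ a hcont hsq, cfc_mul _ _ a hid hid, cfc_id' ℝ a, hr]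
  -- With a = |x|, v = x (a + t)⁻¹ replaces the polar partial isometry: v†v = (a / (a + t))² ≤ 1 and
  -- v†x + t - a = t² / (a + t) ≥ 0.
  refine ⟨x * r, ?_, ?_⟩
  · have h1 : star (x * r) * (x * r) = cfc (fun s : ℝ => (s + t)⁻¹ * (s * s) * (s + t)⁻¹) a := by
      rw [star_mul, hrsa, cfc_mul _ _ a hmul hcont, ← hraa, ← hr, ← hxa]
      simp only [mul_assoc]
    have h2 : ‖x * r‖ * ‖x * r‖ ≤ 1 := by
      rw [← CStarRing.norm_star_mul_self, h1]
      refine norm_cfc_le zero_le_one fun s hs => ?_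
      have hs0 := hspec s hs
      have : (s + t)⁻¹ * (s * s) * (s + t)⁻¹ = (s / (s + t)) ^ 2 := by
        field_simp
      rw [this, Real.norm_of_nonneg (by positivity)]
      exact pow_le_one₀ (by positivity) ((div_le_one (by positivity)).2 (by linarith))
    nlinarith [norm_nonneg (x * r)]
  · rw [star_mul, hrsa, mul_assoc, hxa, hraa, ← cfc_add_const t _ a hmul]
    conv_lhs => rw [← cfc_id' ℝ a]
    refine cfc_mono (fun s hs => ?_) hid (hmul.add continuousOn_const)
    have hs0 := hspec s hs
    have : (s + t)⁻¹ * (s * s) + t - s = t ^ 2 / (s + t) := by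
      field_simp
      ring
    have h2 : 0 ≤ t ^ 2 / (s + t) := by positivity
    linarith

/-- Hölder's inequality `‖√τ √ρ‖₁ ≤ 1` for states. -/
theorem traceNorm_sqrt_mul_sqrt_le_one (τ ρ : State H) :
    traceNorm (CFC.sqrt τ.op * CFC.sqrt ρ.op) ≤ 1 := by
  set X := CFC.sqrt τ.op * CFC.sqrt ρ.op with hX
  rw [traceNorm, posTrace, ENNReal.tsum_eq_iSup_sum]
  refine iSup_le fun F => ?_
  -- On a finite set of basis vectors the error t of the polar decomposition is paid only finitely
  -- often, so it vanishes as t → 0.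
  have key : ∀ t : ℝ, 0 < t →
      ∑ i ∈ F, (⟪stdBasis H i, CFC.abs X (stdBasis H i)⟫_ℂ).re ≤ 1 + F.card * t := by
    intro t ht
    obtain ⟨V, hV, hle⟩ := exists_contraction_abs_le X ht
    set W := CFC.sqrt τ.op * V with hW
    have hterm : ∀ i, (⟪stdBasis H i, CFC.abs X (stdBasis H i)⟫_ℂ).re ≤
        (‖W (stdBasis H i)‖ ^ 2 + ‖CFC.sqrt ρ.op (stdBasis H i)‖ ^ 2) / 2 + t := by
      intro i
      refine (re_inner_mono hle _).trans ?_
      have h1 : (⟪stdBasis H i, (algebraMap ℝ (H →L[ℂ] H) t) (stdBasis H i)⟫_ℂ).re = t := by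
        rw [Algebra.algebraMap_eq_smul_one, ← Complex.coe_smul, smul_apply, inner_smul_right, one_apply_eq_self,
          inner_self_eq_norm_sq_to_K, (stdBasis H).orthonormal.1 i]
        simp
      rw [add_apply, inner_add_right, Complex.add_re, h1]
      gcongr
      have h2 : ⟪stdBasis H i, (star V * X) (stdBasis H i)⟫_ℂ =
          ⟪W (stdBasis H i), CFC.sqrt ρ.op (stdBasis H i)⟫_ℂ := by
        rw [mul_apply_eq_comp, ContinuousLinearMap.star_eq_adjoint,
          ContinuousLinearMap.adjoint_inner_right, hX, hW,
          mul_apply_eq_comp, mul_apply_eq_comp,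
          ← ContinuousLinearMap.adjoint_inner_left, adjoint_sqrt]
      rw [h2]
      have h3 := (Complex.re_le_norm _).trans
        (norm_inner_le_norm (𝕜 := ℂ) (W (stdBasis H i)) (CFC.sqrt ρ.op (stdBasis H i)))
      nlinarith [sq_nonneg (‖W (stdBasis H i)‖ - ‖CFC.sqrt ρ.op (stdBasis H i)‖)]
    have hsum : ∀ (f : stdIndex H → ℝ) (_ : ∀ i, 0 ≤ f i)
        (_ : ∑' i, ENNReal.ofReal (f i) ≤ 1), ∑ i ∈ F, f i ≤ 1 := by
      intro f hf h
      rw [← ENNReal.ofReal_le_one, ENNReal.ofReal_sum_of_nonneg fun i _ => hf i]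
      exact (ENNReal.sum_le_tsum F).trans h
    have hρ := hsum (fun i => ‖CFC.sqrt ρ.op (stdBasis H i)‖ ^ 2) (fun _ => by positivity)
      (tsum_norm_sqrt_sq ρ).le
    -- Passing to W† = V† √τ puts the contraction on the outside, where it shrinks each vector √τ
    -- eᵢ.
    have hτ := hsum (fun i => ‖W (stdBasis H i)‖ ^ 2) (fun _ => by positivity) <| by
      rw [← tsum_norm_sq_adjoint, ← tsum_norm_sqrt_sq τ]
      refine ENNReal.tsum_le_tsum fun i => ENNReal.ofReal_le_ofReal ?_
      gcongr
      have : ContinuousLinearMap.adjoint W (stdBasis H i) =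
          ContinuousLinearMap.adjoint V (CFC.sqrt τ.op (stdBasis H i)) := by
        change (star W) _ = _
        rw [hW, star_mul]
        change (star V) ((ContinuousLinearMap.adjoint (CFC.sqrt τ.op)) _) = _
        rw [adjoint_sqrt]
        rfl
      rw [this]
      refine (ContinuousLinearMap.le_opNorm _ _).trans ?_
      rw [LinearIsometryEquiv.norm_map]
      exact mul_le_of_le_one_left (norm_nonneg _) hV
    calc _ ≤ ∑ i ∈ F, ((‖W (stdBasis H i)‖ ^ 2 + ‖CFC.sqrt ρ.op (stdBasis H i)‖ ^ 2) / 2 + t) :=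
          Finset.sum_le_sum fun i _ => hterm i
      _ = (∑ i ∈ F, ‖W (stdBasis H i)‖ ^ 2 + ∑ i ∈ F, ‖CFC.sqrt ρ.op (stdBasis H i)‖ ^ 2) / 2 +
          F.card * t := by
        rw [Finset.sum_add_distrib, ← Finset.sum_div, Finset.sum_add_distrib, Finset.sum_const,
          nsmul_eq_mul]
      _ ≤ _ := by linarith
  rw [← ENNReal.ofReal_sum_of_nonneg fun i _ => re_inner_nonneg (CFC.abs_nonneg X) _,
    ENNReal.ofReal_le_one]
  refine le_of_forall_pos_le_add fun e he => ?_
  have hpos : (0 : ℝ) < F.card + 1 := by positivity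
  refine (key (e / (F.card + 1)) (by positivity)).trans ?_
  have : F.card * (e / (F.card + 1)) ≤ e := by
    rw [mul_div_assoc', div_le_iff₀ hpos]
    nlinarith
  linarith

/-! ### Monotonicity of the fidelity. -/

theorem sqrt_coe_smul {r : ℝ} (hr : 0 ≤ r) {T : H →L[ℂ] H} (hT : 0 ≤ T) :
    CFC.sqrt ((r : ℂ) • T) = ((√r : ℝ) : ℂ) • CFC.sqrt T := by
  rw [CFC.sqrt_eq_iff _ _ (coe_smul_nonneg hr hT)
    (coe_smul_nonneg (Real.sqrt_nonneg r) (CFC.sqrt_nonneg T)), smul_mul_smul_comm,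
    CFC.sqrt_mul_sqrt_self T hT, ← Complex.ofReal_mul, Real.mul_self_sqrt hr]

theorem star_sqrt_mul_mul_sqrt_mul {T : H →L[ℂ] H} (hT : 0 ≤ T) (S : H →L[ℂ] H) :
    star (CFC.sqrt T * S) * (CFC.sqrt T * S) = star S * T * S := by
  have h : star (CFC.sqrt T) = CFC.sqrt T := adjoint_sqrt T
  rw [star_mul, h, mul_assoc, ← mul_assoc (CFC.sqrt T), CFC.sqrt_mul_sqrt_self T hT, mul_assoc]

/-- Since |√S Q| = √(Q† S Q), this follows from conjugation by Q preserving the order and from the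
square root being operator monotone. It is applied with Q = √ρ. -/
theorem smul_abs_sqrt_mul_le {S T : H →L[ℂ] H} (hS : 0 ≤ S) (hT : 0 ≤ T) {r : ℝ} (hr : 0 ≤ r)
    (h : (r : ℂ) • S ≤ T) (Q : H →L[ℂ] H) :
    ((√r : ℝ) : ℂ) • CFC.abs (CFC.sqrt S * Q) ≤ CFC.abs (CFC.sqrt T * Q) := by
  have h1 : (r : ℂ) • (star Q * S * Q) ≤ star Q * T * Q := by
    have := star_left_conjugate_le_conjugate h Q
    rwa [mul_smul_comm, smul_mul_assoc] at this
  have h2 : 0 ≤ star Q * S * Q := star_left_conjugate_nonneg hS Q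
  rw [CFC.abs, CFC.abs, star_sqrt_mul_mul_sqrt_mul hS, star_sqrt_mul_mul_sqrt_mul hT,
    ← sqrt_coe_smul hr h2]
  exact CFC.sqrt_le_sqrt _ _ h1

/-- Monotonicity and homogeneity of the fidelity in the first argument. -/
theorem mul_fidelity_le {τ ω ρ : State H} {r : ℝ} (hr : 0 ≤ r) (h : (r : ℂ) • τ.op ≤ ω.op) :
    r * fidelity τ ρ ≤ fidelity ω ρ := by
  have habs := smul_abs_sqrt_mul_le τ.nonneg ω.nonneg hr h (CFC.sqrt ρ.op)
  have htr := posTrace_mono habs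
  rw [posTrace_smul (Real.sqrt_nonneg r)] at htr
  -- Finiteness is essential, since `toReal` sends ∞ to 0.
  have hfin := ne_top_of_le_ne_top ENNReal.one_ne_top (traceNorm_sqrt_mul_sqrt_le_one ω ρ)
  have h2 := ENNReal.toReal_mono hfin htr
  rw [ENNReal.toReal_mul, ENNReal.toReal_ofReal (Real.sqrt_nonneg r)] at h2
  have h3 := pow_le_pow_left₀ (by positivity) h2 2
  rwa [mul_pow, Real.sq_sqrt hr] at h3

theorem fidelity_le_one (τ ρ : State H) : fidelity τ ρ ≤ 1 := by
  refine pow_le_one₀ ENNReal.toReal_nonneg ?_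
  exact ENNReal.toReal_le_of_le_ofReal zero_le_one
    (by simpa using traceNorm_sqrt_mul_sqrt_le_one τ ρ)

/-! ### Mixing two states. -/

/-- The convex combination `(1 - η) τ + η σ` of two states. -/
def State.mix (τ σ : State H) (η : ℝ) (h0 : 0 ≤ η) (h1 : η ≤ 1) : State H where
  op := ((1 - η : ℝ) : ℂ) • τ.op + (η : ℂ) • σ.op
  nonneg := add_nonneg (coe_smul_nonneg (sub_nonneg.2 h1) τ.nonneg) (coe_smul_nonneg h0 σ.nonneg)
  trace_eq_one := by
    rw [posTrace_add (coe_smul_nonneg (sub_nonneg.2 h1) τ.nonneg) (coe_smul_nonneg h0 σ.nonneg),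
      posTrace_smul (sub_nonneg.2 h1), posTrace_smul h0, τ.trace_eq_one, σ.trace_eq_one, mul_one,
      mul_one, ← ENNReal.ofReal_add (sub_nonneg.2 h1) h0]
    simp

/-- 1 - F(ω, ρ) ≤ (1 - F(τ, ρ)) + η F(τ, ρ) ≤ ε² + η for the mixture ω, using F ≤ 1. -/
theorem sineDistance_mix_le {τ σ ρ : State H} {η ε : ℝ} (h0 : 0 ≤ η) (h1 : η ≤ 1)
    (hε : sineDistance τ ρ ≤ ε) : sineDistance (τ.mix σ η h0 h1) ρ ≤ √(ε ^ 2 + η) := by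
  have hle : ((1 - η : ℝ) : ℂ) • τ.op ≤ (τ.mix σ η h0 h1).op :=
    le_add_of_nonneg_right (coe_smul_nonneg h0 σ.nonneg)
  have hF := mul_fidelity_le (ρ := ρ) (sub_nonneg.2 h1) hle
  refine Real.sqrt_le_sqrt ?_
  have h2 : 1 - fidelity τ ρ ≤ ε ^ 2 :=
    (Real.sqrt_le_left ((Real.sqrt_nonneg _).trans hε)).1 hε
  nlinarith [fidelity_le_one τ ρ]

theorem one_le_of_op_le_smul {τ σ : State H} {c : ℝ} (hc : 0 ≤ c) (h : τ.op ≤ (c : ℂ) • σ.op) :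
    1 ≤ c := by
  have := posTrace_mono h
  rwa [posTrace_smul hc, τ.trace_eq_one, σ.trace_eq_one, mul_one, ENNReal.one_le_ofReal] at this

/-- Because c ≥ 1, the state σ also lies below c σ, so both parts of the mixture do. -/
theorem mix_op_le {τ σ : State H} {η c : ℝ} (h0 : 0 ≤ η) (h1 : η ≤ 1) (hc : 0 ≤ c)
    (h : τ.op ≤ (c : ℂ) • σ.op) : (τ.mix σ η h0 h1).op ≤ (c : ℂ) • σ.op := by
  have hc1 := one_le_of_op_le_smul hc h
  have hσ : σ.op ≤ (c : ℂ) • σ.op := by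
    have := coe_smul_nonneg (sub_nonneg.2 hc1) σ.nonneg
    rwa [Complex.ofReal_sub, Complex.ofReal_one, sub_smul, one_smul, sub_nonneg] at this
  calc _ ≤ ((1 - η : ℝ) : ℂ) • ((c : ℂ) • σ.op) + (η : ℂ) • ((c : ℂ) • σ.op) :=
        add_le_add (coe_smul_mono (sub_nonneg.2 h1) h) (coe_smul_mono h0 hσ)
    _ = _ := by
      rw [← add_smul, ← Complex.ofReal_add]
      simp

end Trace

/-! ### Tensor products of operators and the product basis. -/

section Bipartite

variable {HA HE : Type*} [NormedAddCommGroup HA] [InnerProductSpace ℂ HA]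
  [NormedAddCommGroup HE] [InnerProductSpace ℂ HE]

theorem inner_pure (x x' : HA) (y y' : HE) :
    ⟪((x ⊗ₜ[ℂ] y : HA ⊗[ℂ] HE) : HTensor HA HE), ((x' ⊗ₜ[ℂ] y' : HA ⊗[ℂ] HE) : HTensor HA HE)⟫_ℂ =
      ⟪x, x'⟫_ℂ * ⟪y, y'⟫_ℂ := by
  rw [UniformSpace.Completion.inner_coe, TensorProduct.inner_tmul]

/-- Bounded operators that agree on pure tensors are equal. -/
theorem clm_ext_pure {F : Type*} [NormedAddCommGroup F] [NormedSpace ℂ F]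
    {S T : HTensor HA HE →L[ℂ] F}
    (h : ∀ x y, S ((x ⊗ₜ[ℂ] y : HA ⊗[ℂ] HE) : HTensor HA HE) =
      T ((x ⊗ₜ[ℂ] y : HA ⊗[ℂ] HE) : HTensor HA HE)) : S = T := by
  ext z
  induction z using UniformSpace.Completion.induction_on with
  | hp => exact isClosed_eq S.continuous T.continuous
  | ih z =>
    induction z using TensorProduct.induction_on with
    | zero => exact (map_zero S).trans (map_zero T).symm
    | tmul x y => exact h x y
    | add a b ha hb => simp only [UniformSpace.Completion.coe_add, map_add, ha, hb]

theorem eq_of_inner_pure {z w : HTensor HA HE}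
    (h : ∀ x y, ⟪z, ((x ⊗ₜ[ℂ] y : HA ⊗[ℂ] HE) : HTensor HA HE)⟫_ℂ =
      ⟪w, ((x ⊗ₜ[ℂ] y : HA ⊗[ℂ] HE) : HTensor HA HE)⟫_ℂ) : z = w := by
  have : innerSL ℂ z = innerSL ℂ w := clm_ext_pure fun x y => by simpa using h x y
  exact ext_inner_right ℂ fun v => by simpa using DFunLike.congr_fun this v

theorem opTensor_add_right (S : HA →L[ℂ] HA) (T T' : HE →L[ℂ] HE) :
    opTensor S (T + T') = opTensor S T + opTensor S T' :=
  clm_ext_pure fun x y => by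
    rw [add_apply, opTensor_tmul, opTensor_tmul, opTensor_tmul, add_apply,
      TensorProduct.tmul_add, UniformSpace.Completion.coe_add]

theorem opTensor_smul_right (S : HA →L[ℂ] HA) (T : HE →L[ℂ] HE) (c : ℂ) :
    opTensor S (c • T) = c • opTensor S T :=
  clm_ext_pure fun x y => by
    rw [smul_apply, opTensor_tmul, opTensor_tmul, smul_apply,
      TensorProduct.tmul_smul, UniformSpace.Completion.coe_smul]

theorem opTensor_mul (S S' : HA →L[ℂ] HA) (T T' : HE →L[ℂ] HE) :
    opTensor (S * S') (T * T') = opTensor S T * opTensor S' T' :=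
  clm_ext_pure fun x y => by
    rw [mul_apply_eq_comp, opTensor_tmul, opTensor_tmul, opTensor_tmul]
    rfl

variable [CompleteSpace HA] [CompleteSpace HE]

theorem adjoint_opTensor (S : HA →L[ℂ] HA) (T : HE →L[ℂ] HE) :
    ContinuousLinearMap.adjoint (opTensor S T) =
      opTensor (ContinuousLinearMap.adjoint S) (ContinuousLinearMap.adjoint T) :=
  clm_ext_pure fun x y => eq_of_inner_pure fun x' y' => by
    rw [ContinuousLinearMap.adjoint_inner_left, opTensor_tmul, opTensor_tmul, inner_pure,
      inner_pure, ContinuousLinearMap.adjoint_inner_left, ContinuousLinearMap.adjoint_inner_left]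

/-- S ⊗ T = R†R with R = √S ⊗ √T. -/
theorem opTensor_nonneg {S : HA →L[ℂ] HA} {T : HE →L[ℂ] HE} (hS : 0 ≤ S) (hT : 0 ≤ T) :
    0 ≤ opTensor S T := by
  have h : opTensor S T =
      star (opTensor (CFC.sqrt S) (CFC.sqrt T)) * opTensor (CFC.sqrt S) (CFC.sqrt T) := by
    rw [ContinuousLinearMap.star_eq_adjoint, adjoint_opTensor, adjoint_sqrt, adjoint_sqrt,
      ← opTensor_mul, CFC.sqrt_mul_sqrt_self S hS, CFC.sqrt_mul_sqrt_self T hT]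
  rw [h]
  exact star_mul_self_nonneg (opTensor (CFC.sqrt S) (CFC.sqrt T))

omit [CompleteSpace HA] in
theorem adjoint_tensorLeft_pure (x x' : HA) (y : HE) :
    ContinuousLinearMap.adjoint (tensorLeft (HE := HE) x)
      ((x' ⊗ₜ[ℂ] y : HA ⊗[ℂ] HE) : HTensor HA HE) = ⟪x, x'⟫_ℂ • y :=
  ext_inner_left ℂ fun v => by
    rw [ContinuousLinearMap.adjoint_inner_right, tensorLeft_apply, inner_pure, inner_smul_right]

/-- A vector orthogonal to the range of a Hilbert basis is zero. -/
theorem eq_zero_of_inner_basis {H ι : Type*} [NormedAddCommGroup H] [InnerProductSpace ℂ H]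
    (b : HilbertBasis ι ℂ H) {z : H} (h : ∀ i, ⟪b i, z⟫_ℂ = 0) : z = 0 := by
  refine b.repr.injective ?_
  ext i
  rw [b.repr_apply_apply, h, map_zero]
  rfl

theorem orthonormal_pure :
    Orthonormal ℂ fun p : stdIndex HA × stdIndex HE =>
      ((stdBasis HA p.1 ⊗ₜ[ℂ] stdBasis HE p.2 : HA ⊗[ℂ] HE) : HTensor HA HE) :=
  ((stdBasis HA).orthonormal.tmul (stdBasis HE).orthonormal).comp_linearIsometry
    (UniformSpace.Completion.toComplₗᵢ (𝕜 := ℂ))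

variable (HA HE) in
/-- The product Hilbert basis of `HA ⊗ HE`. -/
def prodBasis : HilbertBasis (stdIndex HA × stdIndex HE) ℂ (HTensor HA HE) :=
  HilbertBasis.mkOfOrthogonalEqBot orthonormal_pure <| by
    rw [Submodule.eq_bot_iff]
    intro z hz
    have h0 : ∀ i j,
        ⟪((stdBasis HA i ⊗ₜ[ℂ] stdBasis HE j : HA ⊗[ℂ] HE) : HTensor HA HE), z⟫_ℂ = 0 :=
      fun i j => (Submodule.mem_orthogonal _ _).1 hz _ (Submodule.subset_span ⟨(i, j), rfl⟩)
    -- Completeness one factor at a time: first the slices of z along the basis of `HE` vanish, then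
    -- those along every x in `HA`, so z is orthogonal to all pure tensors.
    have h1 : ∀ j, ContinuousLinearMap.adjoint (tensorRight (HA := HA) (stdBasis HE j)) z = 0 :=
      fun j => eq_zero_of_inner_basis (stdBasis HA) fun i => by
        rw [ContinuousLinearMap.adjoint_inner_right, tensorRight_apply, h0]
    have h2 : ∀ x : HA, ContinuousLinearMap.adjoint (tensorLeft (HE := HE) x) z = 0 :=
      fun x => eq_zero_of_inner_basis (stdBasis HE) fun j => by
        rw [ContinuousLinearMap.adjoint_inner_right, tensorLeft_apply, ← tensorRight_apply,
          ← ContinuousLinearMap.adjoint_inner_right, h1, inner_zero_right]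
    refine eq_of_inner_pure fun x y => ?_
    rw [← tensorLeft_apply, ← ContinuousLinearMap.adjoint_inner_left, h2, inner_zero_left,
      inner_zero_left]

theorem prodBasis_apply (p : stdIndex HA × stdIndex HE) :
    prodBasis HA HE p =
      ((stdBasis HA p.1 ⊗ₜ[ℂ] stdBasis HE p.2 : HA ⊗[ℂ] HE) : HTensor HA HE) := by
  rw [prodBasis, HilbertBasis.coe_mkOfOrthogonalEqBot]

/-! ### Marginals and their traces. -/

theorem nonneg_compression {H K : Type*} [NormedAddCommGroup H] [InnerProductSpace ℂ H]
    [CompleteSpace H] [NormedAddCommGroup K] [InnerProductSpace ℂ K] [CompleteSpace K]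
    {T : H →L[ℂ] H} (hT : 0 ≤ T) (V : K →L[ℂ] H) :
    0 ≤ ContinuousLinearMap.adjoint V ∘L T ∘L V :=
  (ContinuousLinearMap.nonneg_iff_isPositive _).2
    (((ContinuousLinearMap.nonneg_iff_isPositive _).1 hT).adjoint_conj V)

theorem marginalA_nonneg (ρ : State (HTensor HA HE)) : 0 ≤ marginalA ρ.op :=
  tsum_nonneg fun _ => nonneg_compression ρ.nonneg _

theorem marginalE_nonneg (ρ : State (HTensor HA HE)) : 0 ≤ marginalE ρ.op :=
  tsum_nonneg fun _ => nonneg_compression ρ.nonneg _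

/-- A quadratic form of a convergent series of positive operators. -/
theorem ofReal_re_inner_tsum {H ι : Type*} [NormedAddCommGroup H] [InnerProductSpace ℂ H]
    [CompleteSpace H] {T : ι → H →L[ℂ] H} (hT : ∀ i, 0 ≤ T i) (hs : Summable T) (x : H) :
    ENNReal.ofReal (⟪x, (∑' i, T i) x⟫_ℂ).re = ∑' i, ENNReal.ofReal (⟪x, T i x⟫_ℂ).re := by
  have h1 : HasSum (fun i => T i x) ((∑' i, T i) x) :=
    hs.hasSum.mapL (ContinuousLinearMap.apply ℂ H x)
  have h2 : HasSum (fun i => (⟪x, T i x⟫_ℂ).re) (⟪x, (∑' i, T i) x⟫_ℂ).re :=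
    Complex.hasSum_re (h1.mapL (innerSL ℂ x))
  rw [← h2.tsum_eq, ENNReal.ofReal_tsum_of_nonneg (fun i => re_inner_nonneg (hT i) x) h2.summable]

theorem posTrace_eq_tsum_prod {T : HTensor HA HE →L[ℂ] HTensor HA HE} (hT : 0 ≤ T) :
    posTrace T = ∑' (i : stdIndex HA) (j : stdIndex HE), ENNReal.ofReal
      (⟪((stdBasis HA i ⊗ₜ[ℂ] stdBasis HE j : HA ⊗[ℂ] HE) : HTensor HA HE),
        T ((stdBasis HA i ⊗ₜ[ℂ] stdBasis HE j : HA ⊗[ℂ] HE) : HTensor HA HE)⟫_ℂ).re := by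
  rw [posTrace_eq_tsum (prodBasis HA HE) hT, ENNReal.tsum_prod']
  simp only [prodBasis_apply]

theorem posTrace_marginalA (ρ : State (HTensor HA HE)) : posTrace (marginalA ρ.op) = 1 := by
  rw [← ρ.trace_eq_one, posTrace_eq_tsum_prod ρ.nonneg, posTrace]
  refine tsum_congr fun i => ?_
  rw [marginalA, ofReal_re_inner_tsum (fun _ => nonneg_compression ρ.nonneg _)
    (summable_marginalA ρ)]
  refine tsum_congr fun j => ?_
  rw [ContinuousLinearMap.comp_apply, ContinuousLinearMap.comp_apply,
    ContinuousLinearMap.adjoint_inner_right, tensorRight_apply]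

theorem posTrace_marginalE (ρ : State (HTensor HA HE)) : posTrace (marginalE ρ.op) = 1 := by
  rw [← ρ.trace_eq_one, posTrace_eq_tsum_prod ρ.nonneg, posTrace, ENNReal.tsum_comm]
  refine tsum_congr fun j => ?_
  rw [marginalE, ofReal_re_inner_tsum (fun _ => nonneg_compression ρ.nonneg _)
    (summable_marginalE ρ)]
  refine tsum_congr fun i => ?_
  rw [ContinuousLinearMap.comp_apply, ContinuousLinearMap.comp_apply,
    ContinuousLinearMap.adjoint_inner_right, tensorLeft_apply]

theorem posTrace_opTensor {S : HA →L[ℂ] HA} {T : HE →L[ℂ] HE} (hS : 0 ≤ S) (hT : 0 ≤ T) :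
    posTrace (opTensor S T) = posTrace S * posTrace T := by
  rw [posTrace_eq_tsum_prod (opTensor_nonneg hS hT), posTrace, posTrace, ← ENNReal.tsum_mul_right]
  refine tsum_congr fun i => ?_
  rw [← ENNReal.tsum_mul_left]
  refine tsum_congr fun j => ?_
  rw [opTensor_tmul, inner_pure, inner_eq_norm_sqrt_sq hS, inner_eq_norm_sqrt_sq hT,
    ← Complex.ofReal_mul, Complex.ofReal_re, Complex.ofReal_re, Complex.ofReal_re,
    ENNReal.ofReal_mul (by positivity)]

/-- The product `ρ_A ⊗ ρ_E` of the marginals of a state. -/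
def State.prodMarginals (ρ : State (HTensor HA HE)) : State (HTensor HA HE) where
  op := opTensor (marginalA ρ.op) (marginalE ρ.op)
  nonneg := opTensor_nonneg (marginalA_nonneg ρ) (marginalE_nonneg ρ)
  trace_eq_one := by
    rw [posTrace_opTensor (marginalA_nonneg ρ) (marginalE_nonneg ρ), posTrace_marginalA,
      posTrace_marginalE, one_mul]

/-- The i-th compression is ⟨eᵢ, S eᵢ⟩ T, and these scalars sum to Tr S = 1. -/
theorem marginalE_opTensor {S : HA →L[ℂ] HA} (hS : 0 ≤ S) (hS1 : posTrace S = 1)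
    (T : HE →L[ℂ] HE) : marginalE (opTensor S T) = T := by
  have h : ∀ i, ContinuousLinearMap.adjoint (tensorLeft (HE := HE) (stdBasis HA i)) ∘L
      opTensor S T ∘L tensorLeft (stdBasis HA i) =
        ⟪stdBasis HA i, S (stdBasis HA i)⟫_ℂ • T := by
    intro i
    ext y
    rw [ContinuousLinearMap.comp_apply, ContinuousLinearMap.comp_apply, tensorLeft_apply,
      opTensor_tmul, adjoint_tensorLeft_pure, smul_apply]
  rw [marginalE]
  simp only [h]
  simpa using ((hasSum_inner_of_posTrace_eq_one hS hS1).smul_const T).tsum_eq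

/-! ### The mixing argument. -/

theorem marginalE_mix (τ σ : State (HTensor HA HE)) {η : ℝ} (h0 : 0 ≤ η) (h1 : η ≤ 1) :
    marginalE (τ.mix σ η h0 h1).op =
      ((1 - η : ℝ) : ℂ) • marginalE τ.op + (η : ℂ) • marginalE σ.op := by
  refine HasSum.tsum_eq ?_
  refine (((summable_marginalE τ).hasSum.const_smul ((1 - η : ℝ) : ℂ)).add
    ((summable_marginalE σ).hasSum.const_smul (η : ℂ))).congr_fun ?_
  intro i
  ext y
  simp [State.mix]

/-- For the mixture ω, ρ_A ⊗ ω_E = (1 - η) ρ_A ⊗ τ_E + η ρ_A ⊗ ρ_E; drop the first, positive term.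
-/
theorem smul_prodMarginals_le (τ ρ : State (HTensor HA HE)) {η : ℝ} (h0 : 0 ≤ η) (h1 : η ≤ 1) :
    (η : ℂ) • ρ.prodMarginals.op ≤
      opTensor (marginalA ρ.op) (marginalE (τ.mix ρ.prodMarginals η h0 h1).op) := by
  rw [marginalE_mix, opTensor_add_right, opTensor_smul_right, opTensor_smul_right]
  have h : marginalE ρ.prodMarginals.op = marginalE ρ.op :=
    marginalE_opTensor (marginalA_nonneg ρ) (posTrace_marginalA ρ) _
  rw [h]
  exact le_add_of_nonneg_left (coe_smul_nonneg (sub_nonneg.2 h1)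
    (opTensor_nonneg (marginalA_nonneg ρ) (marginalE_nonneg τ)))

theorem altSmoothMaxInfo_le_of_op_le (ρ τ : State (HTensor HA HE)) {ε ε' η l : ℝ} (h0 : 0 < η)
    (h1 : η ≤ 1) (hτ : τ.op ≤ (((2 : ℝ) ^ l : ℝ) : ℂ) • ρ.prodMarginals.op)
    (hε : sineDistance τ ρ ≤ ε) (hε' : √(ε ^ 2 + η) ≤ ε') :
    altSmoothMaxInfo ε' ρ ≤ ((l + Real.logb 2 (1 / η) : ℝ) : EReal) := by
  refine iInf₂_le_of_le (τ.mix ρ.prodMarginals η h0.le h1)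
    ((sineDistance_mix_le h0.le h1 hε).trans hε') (iInf₂_le _ ?_)
  have hc : (0 : ℝ) ≤ 2 ^ l := by positivity
  have hpow : (2 : ℝ) ^ (l + Real.logb 2 (1 / η)) = 2 ^ l * (1 / η) := by
    rw [Real.rpow_add two_pos, Real.rpow_logb two_pos (by norm_num) (by positivity)]
  have hle := coe_smul_mono (r := 2 ^ l * (1 / η)) (by positivity)
    (smul_prodMarginals_le τ ρ h0.le h1)
  have hmul : 2 ^ l * (1 / η) * η = 2 ^ l := by field_simp
  rw [smul_smul, ← Complex.ofReal_mul, hmul] at hle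
  rw [hpow]
  exact (mix_op_le h0.le h1 hc hτ).trans hle

end Bipartite

end QInfo

end

theorem mainTheorem9 {HA HE : Type*}
    [NormedAddCommGroup HA] [InnerProductSpace ℂ HA] [CompleteSpace HA]
    [TopologicalSpace.SeparableSpace HA]
    [NormedAddCommGroup HE] [InnerProductSpace ℂ HE] [CompleteSpace HE]
    [TopologicalSpace.SeparableSpace HE]
    (ρ : QInfo.State (QInfo.HTensor HA HE)) (ε δ : ℝ) (hε : 0 < ε) (hδ : 0 < δ)
    (hεδ : ε + δ < 1) :
    QInfo.altSmoothMaxInfo (ε + δ) ρ ≤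
      QInfo.smoothMaxInfo ε ρ + ((Real.logb 2 (8 / δ ^ 2) : ℝ) : EReal) := by
  -- The finite constant is moved across so that the right side is a bare infimum, then moved back
  -- for each candidate l.
  refine (EReal.sub_le_iff_le_add (.inl (EReal.coe_ne_bot _)) (.inl (EReal.coe_ne_top _))).1 ?_
  refine le_iInf₂ fun l ⟨τ, hτ, hdist⟩ => ?_
  refine (EReal.sub_le_iff_le_add (.inl (EReal.coe_ne_bot _)) (.inl (EReal.coe_ne_top _))).2 ?_
  -- The weight η = δ²/8 is dictated by the term log(8/δ²); the distance bound below holds with room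
  -- to spare.
  have hη1 : δ ^ 2 / 8 ≤ 1 := by nlinarith
  have hsqrt : √(ε ^ 2 + δ ^ 2 / 8) ≤ ε + δ :=
    Real.sqrt_le_iff.2 ⟨by linarith, by nlinarith [mul_pos hε hδ]⟩
  have h := QInfo.altSmoothMaxInfo_le_of_op_le ρ τ (by positivity) hη1 hτ hdist hsqrt
  rwa [one_div_div, EReal.coe_add] at h
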